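/- Let $\mathbb{D}=\{z\in\mathbb{C}:|z|\le 1\}$ be the closed unit disc and let $A(\mathbb{D})$ be the algebra of continuous functions $\mathbb{D}\to\mathbb{C}$ that are analytic in the open disc. Let $\eta:\mathbb{D}\to\mathbb{D}$ be a continuous map that is analytic in the open disc. For $x\in\mathbb{D}$ and $f\in A(\mathbb{D})$ let $\pi_x(f)$ be the operator on $\ell^2(\mathbb{N})$ given by $$\pi_x(f)(\xi_0,\xi_1,\xi_2,\dots)=\bigl(f(x)\xi_0,\ f(\eta(x))\xi_1,\ f(\eta^{(2)}(x))\xi_2,\dots\bigr),$$ where $\eta^{(n)}$ is the $n$-th iterate of $\eta$, and let $U_x$ be the forward shift $U_x(\xi_0,\xi_1,\dots)=(0,\xi_0,\xi_1,\dots)$ on $\ell^2(\mathbb{N})$. The semicrossed product $A(\mathbb{D})\times_\eta\mathbb{Z}^+$ is the norm closed algebra of bounded operators on the Hilbert space $\bigoplus_{x\in\mathbb{D}}\ell^2(\mathbb{N})$ that is generated by the operators $\bigoplus_{x\in\mathbb{D}}\pi_x(f)$ and $\bigoplus_{x\in\mathbb{D}}U_x\pi_x(g)$, $f,g\in A(\mathbb{D})$.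 The map $\eta$ is called elliptic if it has exactly one fixed point in $\mathbb{D}$ and this fixed point lies in the open disc. Let $\eta_1,\eta_2:\mathbb{D}\to\mathbb{D}$ be continuous maps that are analytic in the open disc, and assume that $\eta_1$ is not elliptic. Then $A(\mathbb{D})\times_{\eta_1}\mathbb{Z}^+$ and $A(\mathbb{D})\times_{\eta_2}\mathbb{Z}^+$ are isomorphic as complex algebras (no continuity of the isomorphism is required) if and only if there is a homeomorphism $\gamma:\mathbb{D}\to\mathbb{D}$ that is analytic in the open disc and satisfies $\gamma\circ\eta_1=\eta_2\circ\gamma$. -/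

import Mathlib

open scoped ENNReal

noncomputable section

namespace DiscSemicrossed

/-- The closed unit disc `𝔻` of the complex plane. -/
abbrev Disc : Type := Metric.closedBall (0 : ℂ) 1

/-- `f : 𝔻 → ℂ` is analytic in the open unit disc: its restriction to the open disc is the
restriction of a function on `ℂ` that is analytic at every point of the open disc. -/
def AnalyticInside (f : Disc → ℂ) : Prop :=
  ∃ F : ℂ → ℂ, AnalyticOnNhd ℂ F (Metric.ball 0 1) ∧
    ∀ z : Disc, (z : ℂ) ∈ Metric.ball (0 : ℂ) 1 → f z = F z

/-- The disc algebra `A(𝔻)`: continuous functions on the closed disc, analytic in the interior. -/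
def discAlgebra : Subalgebra ℂ C(Disc, ℂ) where
  carrier := {f | AnalyticInside f}
  mul_mem' := by
    rintro f g ⟨F, hF, hf⟩ ⟨G, hG, hg⟩
    exact ⟨F * G, hF.mul hG, fun z hz => by simp [hf z hz, hg z hz]⟩
  add_mem' := by
    rintro f g ⟨F, hF, hf⟩ ⟨G, hG, hg⟩
    exact ⟨F + G, hF.add hG, fun z hz => by simp [hf z hz, hg z hz]⟩
  algebraMap_mem' := fun c => ⟨fun _ => c, analyticOnNhd_const, fun _ _ => rfl⟩

/-- A self-map of the closed disc is elliptic if it has exactly one fixed point and this fixed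
point lies in the open disc. -/
def IsElliptic (η : C(Disc, Disc)) : Prop :=
  ∃ x : Disc, (x : ℂ) ∈ Metric.ball (0 : ℂ) 1 ∧ ∀ y : Disc, η y = y ↔ y = x

/-- The Hilbert space `ℓ²(ℕ)`. -/
abbrev EllTwo : Type := lp (fun _ : ℕ => ℂ) 2

/-- The Hilbert space direct sum `⨁_{x ∈ 𝔻} ℓ²(ℕ)`. -/
abbrev SumSpace : Type := lp (fun _ : Disc => EllTwo) 2

/-- The operator `π_x(f)` on `ℓ²(ℕ)`, `π_x(f) ξ = (f(x) ξ₀, f(η(x)) ξ₁, f(η²(x)) ξ₂, …)`. -/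
def pointRep (η : C(Disc, Disc)) (x : Disc) (f : C(Disc, ℂ)) : EllTwo →L[ℂ] EllTwo :=
  lp.mapCLM 2 (fun n : ℕ => f (η^[n] x) • ContinuousLinearMap.id ℂ ℂ) (norm_nonneg f)
    (fun n => by
      rw [norm_smul, ContinuousLinearMap.norm_id, mul_one]
      exact f.norm_coe_le_norm _)

theorem norm_pointRep_le (η : C(Disc, Disc)) (x : Disc) (f : C(Disc, ℂ)) :
    ‖pointRep η x f‖ ≤ ‖f‖ :=
  lp.norm_mapCLM_le _ _ _ _

/-- The sequence `(0, ξ₀, ξ₁, …)`. -/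
def shiftSeq (ξ : ℕ → ℂ) : ℕ → ℂ
  | 0 => 0
  | n + 1 => ξ n

theorem hasSum_shiftSeq (ξ : EllTwo) :
    HasSum (fun n => ‖shiftSeq ξ n‖ ^ (2 : ℝ≥0∞).toReal) (‖ξ‖ ^ (2 : ℝ≥0∞).toReal) := by
  rw [← hasSum_nat_add_iff' 1]
  simpa [shiftSeq] using lp.hasSum_norm (p := 2) (by norm_num) ξ

/-- The forward shift `ξ ↦ (0, ξ₀, ξ₁, …)` on `ℓ²(ℕ)`. -/
def forwardShift : EllTwo →L[ℂ] EllTwo :=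
  LinearMap.mkContinuous
    { toFun := fun ξ => ⟨shiftSeq ξ, memℓp_gen (hasSum_shiftSeq ξ).summable⟩
      map_add' := fun ξ ζ => by
        ext n
        cases n
        · exact (add_zero (0 : ℂ)).symm
        · rfl
      map_smul' := fun c ξ => by
        ext n
        cases n <;> simp [shiftSeq] }
    1 (fun ξ => lp.norm_le_of_tsum_le (by norm_num) (by positivity) (by
      rw [one_mul]
      exact (hasSum_shiftSeq ξ).tsum_eq.le))

theorem norm_forwardShift_le : ‖forwardShift‖ ≤ 1 :=
  LinearMap.mkContinuous_norm_le _ zero_le_one _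

/-- The operator `⨁_{x ∈ 𝔻} π_x(f)`. -/
def sumRep (η : C(Disc, Disc)) (f : C(Disc, ℂ)) : SumSpace →L[ℂ] SumSpace :=
  lp.mapCLM 2 (fun x : Disc => pointRep η x f) (norm_nonneg f) (fun x => norm_pointRep_le η x f)

/-- The operator `⨁_{x ∈ 𝔻} U_x π_x(g)`, where every `U_x` is the forward shift. -/
def sumShiftRep (η : C(Disc, Disc)) (g : C(Disc, ℂ)) : SumSpace →L[ℂ] SumSpace :=
  lp.mapCLM 2 (fun x : Disc => forwardShift ∘L pointRep η x g) (norm_nonneg g) (fun x => by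
    have h := ContinuousLinearMap.opNorm_comp_le forwardShift (pointRep η x g)
    have h1 := norm_forwardShift_le
    have h2 := norm_pointRep_le η x g
    nlinarith [norm_nonneg (pointRep η x g)])

/-- The semicrossed product `A(𝔻) ×_η ℤ⁺`: the norm closed algebra of operators on
`⨁_{x ∈ 𝔻} ℓ²(ℕ)` generated by `⨁ π_x(f)` and `⨁ U_x π_x(g)` for `f, g ∈ A(𝔻)`. (The identity
operator is the generator with `f = 1`.) -/
def semicrossedProduct (η : C(Disc, Disc)) : Subalgebra ℂ (SumSpace →L[ℂ] SumSpace) :=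
  (Algebra.adjoin ℂ (sumRep η '' discAlgebra ∪ sumShiftRep η '' discAlgebra)).topologicalClosure

end DiscSemicrossed

end

/-!
A character of the semicrossed product is determined by its base point `x` and its value `z` on the
shift `U`, and covariance forces `z = 0` or `η x = x`: the character space is a copy of the closed
disc (the base, `z = 0`) with an open disc of characters attached along each fixed point of `η`.
Unless `η` is the identity, its fixed points are isolated in the open disc, so an analytic disc of
characters lies either in the base or in the fibre over a single fixed point. Analyticity of such a
disc is tested on one element of the algebra at a time, hence is preserved by every algebra
isomorphism, continuous or not.

If an isomorphism does not carry base to base, then both bases collapse into fibres, and each fibre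
goes to an open disc inside the other base. So the fixed point under a fibre lies in the open disc,
and it is the only one, because all fixed points collapse together. Hence both maps are elliptic.

Otherwise the isomorphism induces a homeomorphism `γ` of the base discs. The dynamics is read off
from derivations `D (a b) = φ(a) D(b) + D(a) ψ(b)` twisted by the base characters `φ`, `ψ` at points
`u ≠ y`: these are multiples of `φ - ψ` unless `u = η y`, whereas the coefficient of `U` at `y` is
such a derivation for `u = η y` that does not vanish at `U`. Hence `γ` intertwines the maps off the
fixed points, and everywhere by density. The identity map is recognized by commutativity.
-/

noncomputable section

namespace DiscSemicrossed

open Metric Filter Topology Set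
open scoped ENNReal ComplexConjugate Complex.UnitDisc

theorem not_injOn_sphere_of_continuousOn {E : Type*} [NormedAddCommGroup E] [NormedSpace ℝ E]
    (hE : 1 < Module.rank ℝ E) {r : ℝ} (hr : 0 < r) {f : E → ℝ}
    (hf : ContinuousOn f (sphere 0 r)) : ¬ InjOn f (sphere 0 r) := by
  intro hinj
  have : Nontrivial E := rank_pos_iff_nontrivial.1 (zero_lt_one.trans hE)
  obtain ⟨x, hx⟩ : (sphere (0 : E) r).Nonempty := NormedSpace.sphere_nonempty.2 hr.le
  have hneg : ∀ {y : E}, y ∈ sphere (0 : E) r → -y ∈ sphere (0 : E) r := by simp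
  have hodd : ContinuousOn (fun y => f y - f (-y)) (sphere 0 r) :=
    hf.sub (hf.comp continuousOn_neg fun _ => hneg)
  obtain ⟨y, hy, hy0⟩ : (0 : ℝ) ∈ (fun y => f y - f (-y)) '' sphere 0 r := by
    refine ((isPreconnected_sphere hE 0 r).image _ hodd).ordConnected.uIcc_subset
      (mem_image_of_mem _ hx) (mem_image_of_mem _ (hneg hx)) ?_
    rw [neg_neg, ← neg_sub (f x) (f (-x)), mem_uIcc]
    rcases le_total (f x - f (-x)) 0 with h | h
    · exact Or.inl ⟨h, neg_nonneg.2 h⟩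
    · exact Or.inr ⟨neg_nonpos.2 h, h⟩
  have hyneg : y = -y := hinj hy (hneg hy) (sub_eq_zero.1 hy0)
  have htwo : (2 : ℝ) • y = 0 := by rw [two_smul, add_eq_zero_iff_eq_neg, ← hyneg]
  rw [mem_sphere_zero_iff_norm, (smul_eq_zero_iff_right two_ne_zero).1 htwo, norm_zero] at hy
  exact hr.ne hy

theorem surjOn_circle_of_continuousOn_of_injOn {G : ℂ → ℂ} (hcont : ContinuousOn G (sphere 0 1))
    (hmaps : MapsTo G (sphere 0 1) (sphere 0 1)) (hinj : InjOn G (sphere 0 1)) :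
    SurjOn G (sphere 0 1) (sphere 0 1) := by
  intro b hb
  by_contra hGb
  have hnorm : ∀ z ∈ sphere (0 : ℂ) 1, ‖G z‖ = 1 := fun z hz => by simpa using hmaps hz
  rw [mem_sphere_zero_iff_norm] at hb
  have hb0 : b ≠ 0 := norm_ne_zero_iff.1 (by simp [hb])
  -- Otherwise `G` embeds the circle into the circle without `b`, hence into the line.
  refine not_injOn_sphere_of_continuousOn (E := ℂ) (by simp) one_pos
    (f := fun z => (-(G z / b)).arg) (fun z hz => ?_) (fun z hz z' hz' harg => ?_)
  · refine (Complex.continuousAt_arg ?_).comp_continuousWithinAt ((hcont z hz).div_const _).neg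
    refine Complex.mem_slitPlane_iff_arg.2 ⟨fun harg => hGb ⟨z, hz, ?_⟩, ?_⟩
    · have hdiv : -(G z / b) = -1 :=
        Complex.ext_norm_arg (by simp [hnorm z hz, hb]) (harg.trans Complex.arg_neg_one.symm)
      exact (div_eq_one_iff_eq hb0).1 (neg_inj.1 hdiv)
    · exact neg_ne_zero.2 (div_ne_zero (norm_ne_zero_iff.1 (by simp [hnorm z hz])) hb0)
  · have hdiv : -(G z / b) = -(G z' / b) :=
      Complex.ext_norm_arg (by simp [hnorm z hz, hnorm z' hz']) harg
    exact hinj hz hz' ((div_left_inj' hb0).1 (neg_inj.1 hdiv))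

theorem analyticAt_of_eventually_leftInverse {F G : ℂ → ℂ} {p : ℂ} (hF : AnalyticAt ℂ F (G p))
    (hG : ∀ᶠ z in 𝓝 p, ContinuousAt G z) (hFG : ∀ᶠ z in 𝓝 p, F (G z) = z) :
    AnalyticAt ℂ G p := by
  have hpunctured : Tendsto G (𝓝[≠] p) (𝓝[≠] (G p)) := by
    refine tendsto_nhdsWithin_iff.2 ⟨hG.self_of_nhds.tendsto.mono_left nhdsWithin_le_nhds, ?_⟩
    filter_upwards [self_mem_nhdsWithin, nhdsWithin_le_nhds hFG] with z hz hFGz hGz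
    exact hz (by rw [mem_singleton_iff, ← hFGz, hGz, hFG.self_of_nhds])
  have hnonconst : ¬ ∀ᶠ w in 𝓝 (G p), F w = F (G p) := fun hconst => by
    obtain ⟨z, ⟨hFz, hFGz⟩, hz⟩ := (((hpunctured.mono_right nhdsWithin_le_nhds).eventually
      hconst).and (nhdsWithin_le_nhds hFG)).and self_mem_nhdsWithin |>.exists
    exact hz (by rw [← hFGz, hFz, hFG.self_of_nhds]; rfl)
  have hderiv : ∀ᶠ w in 𝓝[≠] (G p), deriv F w ≠ 0 := by
    refine hF.deriv.eventually_eq_zero_or_eventually_ne_zero.resolve_left fun hzero => ?_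
    obtain ⟨ε, hε, hball⟩ := eventually_nhds_iff_ball.1 (hzero.and hF.eventually_analyticAt)
    refine hnonconst (eventually_nhds_iff_ball.2 ⟨ε, hε, fun w hw => ?_⟩)
    exact isOpen_ball.is_const_of_deriv_eq_zero (convex_ball _ _).isPreconnected
      (fun w hw => (hball w hw).2.differentiableAt.differentiableWithinAt)
      (fun w hw => (hball w hw).1) hw (mem_ball_self hε)
  refine Complex.analyticAt_of_differentiable_on_punctured_nhds_of_continuousAt ?_ hG.self_of_nhds
  filter_upwards [hpunctured.eventually hderiv,
    (hpunctured.mono_right nhdsWithin_le_nhds).eventually hF.eventually_analyticAt,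
    nhdsWithin_le_nhds hG, nhdsWithin_le_nhds hFG.eventually_nhds] with z hne hFz hGz hFGz
  exact (hFz.differentiableAt.hasDerivAt.of_local_left_inverse hGz hne hFGz).differentiableAt

/-! ### Functions on the disc -/

instance : ConnectedSpace Disc :=
  isConnected_iff_connectedSpace.1 ((convex_closedBall (0 : ℂ) 1).isConnected ⟨0, by simp⟩)

instance : Nontrivial Disc :=
  ⟨⟨0, by simp⟩, ⟨1, by simp⟩, fun h => zero_ne_one (congrArg Subtype.val h)⟩

/-- Extension by zero of a function on the closed disc to the plane, so that the analysis of
functions on `ℂ` applies to it. -/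
def discExtend (f : Disc → ℂ) : ℂ → ℂ :=
  Function.extend Subtype.val f 0

@[simp] theorem discExtend_coe (f : Disc → ℂ) (z : Disc) : discExtend f z = f z :=
  Subtype.val_injective.extend_apply f 0 z

theorem discExtend_of_mem_ball (f : Disc → ℂ) {z : ℂ} (hz : z ∈ ball (0 : ℂ) 1) :
    discExtend f z = f ⟨z, ball_subset_closedBall hz⟩ :=
  discExtend_coe f ⟨z, ball_subset_closedBall hz⟩

theorem continuousOn_discExtend {f : Disc → ℂ} (hf : Continuous f) :
    ContinuousOn (discExtend f) (closedBall 0 1) :=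
  continuousOn_iff_continuous_domRestrict.2 (by
    convert hf using 1
    exact funext (discExtend_coe f))

theorem analyticInside_iff {f : Disc → ℂ} :
    AnalyticInside f ↔ AnalyticOnNhd ℂ (discExtend f) (ball 0 1) := by
  refine ⟨?_, fun h => ⟨_, h, fun z _ => (discExtend_coe f z).symm⟩⟩
  rintro ⟨F, hF, hf⟩
  refine hF.congr isOpen_ball fun z hz => ?_
  rw [discExtend_of_mem_ball f hz, hf _ hz]

theorem isPreconnected_unitBall : IsPreconnected (ball (0 : ℂ) 1) :=
  (convex_ball (0 : ℂ) 1).isPreconnected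

theorem dense_openDisc : Dense {z : Disc | (z : ℂ) ∈ ball (0 : ℂ) 1} := by
  rw [Subtype.dense_iff]
  intro z hz
  have himage : ((↑) '' {z : Disc | (z : ℂ) ∈ ball (0 : ℂ) 1} : Set ℂ) = ball 0 1 :=
    (Subtype.image_preimage_coe _ _).trans (inter_eq_right.2 ball_subset_closedBall)
  rwa [himage, closure_ball _ one_ne_zero]

theorem eq_of_eqOn_openDisc {Y : Type*} [TopologicalSpace Y] [T2Space Y] {f g : Disc → Y}
    (hf : Continuous f) (hg : Continuous g)
    (h : ∀ z : Disc, (z : ℂ) ∈ ball (0 : ℂ) 1 → f z = g z) : f = g :=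
  Continuous.ext_on dense_openDisc hf hg h

theorem eqOn_const_or_mapsTo_ball {F : ℂ → ℂ} (hF : AnalyticOnNhd ℂ F (ball 0 1))
    (hmaps : MapsTo F (ball 0 1) (closedBall 0 1)) :
    (∃ c, ∀ z ∈ ball (0 : ℂ) 1, F z = c) ∨ MapsTo F (ball 0 1) (ball 0 1) := by
  refine (hF.is_constant_or_isOpen isPreconnected_unitBall).imp id fun hopen => ?_
  have hsub : F '' ball 0 1 ⊆ interior (closedBall (0 : ℂ) 1) :=
    interior_maximal hmaps.image_subset (hopen _ subset_rfl isOpen_ball)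
  rwa [interior_closedBall _ one_ne_zero, ← mapsTo_iff_image_subset] at hsub

theorem AnalyticInside.eq_const_or_apply_mem_ball {η : C(Disc, Disc)}
    (hη : AnalyticInside fun z => (η z : ℂ)) :
    (∃ c, ∀ z, η z = c) ∨ ∀ z : Disc, (z : ℂ) ∈ ball (0 : ℂ) 1 → (η z : ℂ) ∈ ball (0 : ℂ) 1 := by
  have hmaps : MapsTo (discExtend fun z => (η z : ℂ)) (ball 0 1) (closedBall 0 1) :=
    fun z hz => by rw [discExtend_of_mem_ball _ hz]; exact (η _).2
  refine (eqOn_const_or_mapsTo_ball (analyticInside_iff.1 hη) hmaps).imp ?_ ?_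
  · rintro ⟨c, hc⟩
    have hconst : ⇑η = fun _ => η ⟨0, by simp⟩ :=
      eq_of_eqOn_openDisc η.continuous continuous_const fun z hz => Subtype.ext <| by
        rw [← discExtend_coe (fun z => (η z : ℂ)), ← discExtend_coe (fun z => (η z : ℂ)),
          hc _ hz, hc _ (by simp)]
    exact ⟨_, congrFun hconst⟩
  · intro h z hz
    simpa only [discExtend_coe] using h hz

theorem AnalyticInside.comp {f : Disc → ℂ} {η : C(Disc, Disc)} (hf : AnalyticInside f)
    (hη : AnalyticInside fun z => (η z : ℂ)) : AnalyticInside (f ∘ η) := by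
  rcases hη.eq_const_or_apply_mem_ball with ⟨c, hc⟩ | hmaps
  · exact ⟨fun _ => f c, analyticOnNhd_const, fun z _ => congrArg f (hc z)⟩
  · obtain ⟨F, hF, hFf⟩ := hf
    refine ⟨F ∘ discExtend fun z => (η z : ℂ), hF.comp (analyticInside_iff.1 hη) fun z hz => ?_,
      fun z hz => ?_⟩
    · rw [discExtend_of_mem_ball _ hz]
      exact hmaps _ hz
    · simp only [Function.comp_apply, discExtend_coe, hFf _ (hmaps z hz)]

theorem comp_mem_discAlgebra {f : C(Disc, ℂ)} (hf : f ∈ discAlgebra) {η : C(Disc, Disc)}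
    (hη : AnalyticInside fun z => (η z : ℂ)) : f.comp η ∈ discAlgebra :=
  AnalyticInside.comp (f := f) hf hη

theorem norm_eq_one_of_notMem_ball {z : Disc} (hz : (z : ℂ) ∉ ball (0 : ℂ) 1) : ‖(z : ℂ)‖ = 1 :=
  le_antisymm (mem_closedBall_zero_iff.1 z.2) (by simpa using hz)

theorem mem_ball_of_homeomorph_apply_mem_ball {γ : Disc ≃ₜ Disc}
    (hγ : AnalyticInside fun z => (γ z : ℂ)) {b : Disc} (hγb : (γ b : ℂ) ∈ ball (0 : ℂ) 1) :
    (b : ℂ) ∈ ball (0 : ℂ) 1 := by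
  have hball : ∀ z : Disc, (z : ℂ) ∈ ball (0 : ℂ) 1 → (γ z : ℂ) ∈ ball (0 : ℂ) 1 := by
    refine (AnalyticInside.eq_const_or_apply_mem_ball (η := γ) hγ).resolve_left ?_
    rintro ⟨c, hc⟩
    have h01 := γ.injective ((hc ⟨0, by simp⟩).trans (hc ⟨1, by simp⟩).symm)
    simp at h01
  set G := discExtend fun z => (γ.symm z : ℂ)
  have hGsymm : ∀ z (hz : z ∈ sphere (0 : ℂ) 1), G z = γ.symm ⟨z, sphere_subset_closedBall hz⟩ :=
    fun z hz => discExtend_coe (fun z => (γ.symm z : ℂ)) ⟨z, sphere_subset_closedBall hz⟩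
  have hsurj : SurjOn G (sphere 0 1) (sphere 0 1) := by
    refine surjOn_circle_of_continuousOn_of_injOn
      ((continuousOn_discExtend (by fun_prop)).mono sphere_subset_closedBall)
      (fun z hz => ?_) (fun z hz z' hz' h => ?_)
    · rw [hGsymm z hz, mem_sphere_zero_iff_norm]
      refine norm_eq_one_of_notMem_ball fun h => ?_
      exact (mem_sphere_zero_iff_norm.1 hz).not_lt (by simpa using hball _ h)
    · rw [hGsymm z hz, hGsymm z' hz'] at h
      exact congrArg Subtype.val (γ.symm.injective (Subtype.ext h))
  by_contra hb
  obtain ⟨z, hz, hzb⟩ := hsurj (mem_sphere_zero_iff_norm.2 (norm_eq_one_of_notMem_ball hb))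
  rw [hGsymm z hz] at hzb
  rw [← Subtype.ext hzb, Homeomorph.apply_symm_apply, mem_ball_zero_iff] at hγb
  exact (mem_sphere_zero_iff_norm.1 hz).not_lt hγb

theorem AnalyticInside.homeomorph_symm {γ : Disc ≃ₜ Disc}
    (hγ : AnalyticInside fun z => (γ z : ℂ)) : AnalyticInside fun z => (γ.symm z : ℂ) := by
  refine analyticInside_iff.2 fun p hp => ?_
  set F := discExtend fun z => (γ z : ℂ)
  set G := discExtend fun z => (γ.symm z : ℂ)
  have hFG : ∀ z ∈ ball (0 : ℂ) 1, F (G z) = z := fun z hz => by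
    simp only [F, G, discExtend_of_mem_ball _ hz, discExtend_coe, Homeomorph.apply_symm_apply]
  have hGmaps : G p ∈ ball (0 : ℂ) 1 := by
    simp only [G, discExtend_of_mem_ball _ hp]
    exact mem_ball_of_homeomorph_apply_mem_ball hγ (by simpa using hp)
  have hGcont : ContinuousOn G (ball 0 1) :=
    (continuousOn_discExtend (by fun_prop)).mono ball_subset_closedBall
  have hball := isOpen_ball.eventually_mem hp
  exact analyticAt_of_eventually_leftInverse (analyticInside_iff.1 hγ _ hGmaps)
    (hball.mono fun z hz => hGcont.continuousAt (isOpen_ball.mem_nhds hz)) (hball.mono hFG)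

/-! ### The disc algebra -/

theorem isClosed_discAlgebra : IsClosed (discAlgebra : Set C(Disc, ℂ)) := by
  refine IsSeqClosed.isClosed fun u f hu hf => ?_
  have hunif : TendstoUniformlyOn (fun n => discExtend (u n)) (discExtend f) atTop (ball 0 1) := by
    rw [ContinuousMap.tendsto_iff_tendstoUniformly, tendstoUniformly_iff] at hf
    refine tendstoUniformlyOn_iff.2 fun ε hε => (hf ε hε).mono fun n hn z hz => ?_
    simpa only [discExtend_of_mem_ball _ hz] using hn _
  refine analyticInside_iff.2 (DifferentiableOn.analyticOnNhd ?_ isOpen_ball)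
  exact hunif.tendstoLocallyUniformlyOn.differentiableOn
    (Eventually.of_forall fun n => (analyticInside_iff.1 (hu n)).differentiableOn) isOpen_ball

instance : CompleteSpace discAlgebra := isClosed_discAlgebra.completeSpace_coe

/-- The coordinate function `z`, which generates the disc algebra topologically. -/
def discId : discAlgebra :=
  ⟨⟨Subtype.val, continuous_subtype_val⟩, ⟨id, analyticOnNhd_id, fun _ _ => rfl⟩⟩

@[simp] theorem discId_apply (z : Disc) : (discId : C(Disc, ℂ)) z = z := rfl

theorem norm_discId_le : ‖discId‖ ≤ 1 :=
  (ContinuousMap.norm_le _ zero_le_one).2 fun z => mem_closedBall_zero_iff.1 z.2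

theorem exists_discAlgebra_eq {H : ℂ → ℂ} (hH : AnalyticOnNhd ℂ H (closedBall 0 1)) :
    ∃ f : discAlgebra, ∀ z : Disc, (f : C(Disc, ℂ)) z = H z :=
  ⟨⟨⟨fun z => H z, continuousOn_iff_continuous_domRestrict.1 hH.continuousOn⟩,
    H, hH.mono ball_subset_closedBall, fun _ _ => rfl⟩, fun _ => rfl⟩

theorem analyticOnNhd_dslope {H : ℂ → ℂ} {s : Set ℂ} (hH : AnalyticOnNhd ℂ H s) {w : ℂ}
    (hw : w ∈ s) : AnalyticOnNhd ℂ (dslope H w) s := by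
  have hopen := isOpen_analyticAt ℂ H
  have hdiff : DifferentiableOn ℂ H {z | AnalyticAt ℂ H z} :=
    fun z hz => AnalyticAt.differentiableWithinAt hz
  exact (((Complex.differentiableOn_dslope (hopen.mem_nhds (hH w hw))).2 hdiff).analyticOnNhd
    hopen).mono hH

theorem dense_analyticOnNhd_closedBall :
    Dense {f : discAlgebra | ∃ H : ℂ → ℂ, AnalyticOnNhd ℂ H (closedBall 0 1) ∧
      ∀ z : Disc, (f : C(Disc, ℂ)) z = H z} := by
  intro f
  -- The dilations `z ↦ f (r z)`, `r < 1`, are analytic across the circle and tend to `f`.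
  have hscale : ∀ (r : unitInterval) (z : Disc), ((r : ℝ) : ℂ) * z ∈ closedBall (0 : ℂ) 1 :=
    fun r z => by
      rw [mem_closedBall_zero_iff, norm_mul, Complex.norm_real, Real.norm_of_nonneg r.2.1]
      exact mul_le_one₀ r.2.2 (norm_nonneg _) (mem_closedBall_zero_iff.1 z.2)
  let scale : C(unitInterval × Disc, Disc) :=
    ⟨fun p => ⟨((p.1 : ℝ) : ℂ) * p.2, hscale p.1 p.2⟩, by fun_prop⟩
  let dilation : C(unitInterval, C(Disc, ℂ)) := ((f : C(Disc, ℂ)).comp scale).curry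
  have hone : dilation 1 = f := by
    ext z
    exact congrArg (f : C(Disc, ℂ)) (Subtype.ext (by simp [scale]))
  have hclosure : (1 : unitInterval) ∈ closure (Iio 1) := by
    rw [closure_Iio' ⟨0, zero_lt_one⟩]
    exact self_mem_Iic
  rw [closure_subtype, ← hone]
  refine closure_mono ?_ (image_closure_subset_closure_image dilation.continuous
    (mem_image_of_mem _ hclosure))
  rintro _ ⟨r, hr, rfl⟩
  have hball : MapsTo (fun z : ℂ => ((r : ℝ) : ℂ) * z) (closedBall 0 1) (ball 0 1) := by
    intro z hz
    rw [mem_closedBall_zero_iff] at hz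
    rw [mem_ball_zero_iff, norm_mul, Complex.norm_real, Real.norm_of_nonneg r.2.1]
    exact (mul_le_of_le_one_right r.2.1 hz).trans_lt hr
  have hanalytic : AnalyticOnNhd ℂ (fun z => discExtend f ((r : ℝ) * z)) (closedBall 0 1) :=
    (analyticInside_iff.1 f.2).comp (analyticOnNhd_const.mul analyticOnNhd_id) hball
  obtain ⟨g, hg⟩ := exists_discAlgebra_eq hanalytic
  refine ⟨g, ⟨_, hanalytic, hg⟩, ?_⟩
  ext z
  exact (hg z).trans (discExtend_coe f (scale (r, z)))

theorem algHom_discAlgebra_apply (φ : discAlgebra →ₐ[ℂ] ℂ) {w : Disc} (hw : φ discId = w)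
    (f : discAlgebra) : φ f = (f : C(Disc, ℂ)) w := by
  have heval : Continuous fun f : discAlgebra => (f : C(Disc, ℂ)) w := by fun_prop
  refine congrFun (Continuous.ext_on dense_analyticOnNhd_closedBall (map_continuous φ) heval ?_) f
  rintro g ⟨H, hH, hg⟩
  obtain ⟨h, hh⟩ := exists_discAlgebra_eq (analyticOnNhd_dslope hH w.2)
  have hfactor : g - algebraMap ℂ discAlgebra ((g : C(Disc, ℂ)) w) =
      (discId - algebraMap ℂ discAlgebra w) * h := by
    refine Subtype.ext (ContinuousMap.ext fun z => ?_)
    have hz : (g : C(Disc, ℂ)) z - (g : C(Disc, ℂ)) w = (z - w) * (h : C(Disc, ℂ)) z := by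
      rw [hg, hg, hh]
      exact (sub_smul_dslope H w z).symm
    exact hz
  have hφ := congrArg φ hfactor
  simpa [hw, sub_eq_zero] using hφ

/-! ### Fixed points -/

theorem eq_self_of_eventually_fixed {η : C(Disc, Disc)} (hη : AnalyticInside fun z => (η z : ℂ))
    {c : ℂ} (hfix : ∀ᶠ z in 𝓝 c, ∃ w : Disc, (w : ℂ) = z ∧ η w = w) (z : Disc) : η z = z := by
  have hc : c ∈ ball (0 : ℂ) 1 := by
    rw [← interior_closedBall _ one_ne_zero, mem_interior_iff_mem_nhds]
    filter_upwards [hfix]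
    rintro z ⟨w, rfl, -⟩
    exact w.2
  have hid : EqOn (discExtend fun z => (η z : ℂ)) id (ball 0 1) := by
    refine (analyticInside_iff.1 hη).eqOn_of_preconnected_of_eventuallyEq analyticOnNhd_id
      isPreconnected_unitBall hc ?_
    filter_upwards [hfix]
    rintro z ⟨w, rfl, hw⟩
    simp [hw]
  refine congrFun (eq_of_eqOn_openDisc η.continuous continuous_id fun z hz => Subtype.ext ?_) z
  simpa using hid hz

theorem dense_not_fixed {η : C(Disc, Disc)} (hη : AnalyticInside fun z => (η z : ℂ))
    (hne : ∃ z, η z ≠ z) : Dense {z | η z ≠ z} := by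
  by_contra hdense
  obtain ⟨z₀, hz₀⟩ : (interior {z | η z ≠ z}ᶜ).Nonempty :=
    interior_eq_empty_iff_dense_compl.not.2 (by rwa [compl_compl]) |> nonempty_iff_ne_empty.2
  obtain ⟨c, hc, hcball⟩ := dense_openDisc.inter_open_nonempty _ isOpen_interior ⟨z₀, hz₀⟩
  obtain ⟨z, hz⟩ := hne
  refine hz (eq_self_of_eventually_fixed hη (c := c) ?_ z)
  have hmap : map Subtype.val (𝓝 c) = 𝓝 (c : ℂ) :=
    map_nhds_subtype_coe_eq_nhds c.2 (mem_of_superset (isOpen_ball.mem_nhds hcball)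
      ball_subset_closedBall)
  rw [← hmap, eventually_map]
  filter_upwards [mem_interior_iff_mem_nhds.1 hc] with w hw
  exact ⟨w, rfl, not_not.1 hw⟩

theorem eqOn_zero_or_exists_fixed {η : C(Disc, Disc)} (hη : AnalyticInside fun z => (η z : ℂ))
    (hne : ∃ z, η z ≠ z) {p q : ℂ → ℂ} (hp : AnalyticOnNhd ℂ p (ball 0 1))
    (hq : AnalyticOnNhd ℂ q (ball 0 1))
    (h : ∀ z ∈ ball (0 : ℂ) 1, q z ≠ 0 → ∃ w : Disc, (w : ℂ) = p z ∧ η w = w) :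
    EqOn q 0 (ball 0 1) ∨ ∃ w : Disc, η w = w ∧ ∀ z ∈ ball (0 : ℂ) 1, p z = w := by
  by_contra! ⟨hqne, hpne⟩
  simp only [EqOn, not_forall] at hqne
  obtain ⟨z₀, hz₀, hqz₀⟩ := hqne
  have hfix : ∀ᶠ z in 𝓝 z₀, ∃ w : Disc, (w : ℂ) = p z ∧ η w = w := by
    filter_upwards [isOpen_ball.mem_nhds hz₀, (hq z₀ hz₀).continuousAt.eventually_ne hqz₀]
      with z hz hqz using h z hz hqz
  rcases (hp z₀ hz₀).eventually_constant_or_nhds_le_map_nhds with hconst | hopen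
  · obtain ⟨w, hw, hηw⟩ := hfix.self_of_nhds
    obtain ⟨z, hz, hpz⟩ := hpne w hηw
    refine hpz (hw ▸ ?_)
    exact hp.eqOn_of_preconnected_of_eventuallyEq analyticOnNhd_const isPreconnected_unitBall
      hz₀ hconst hz
  · obtain ⟨z, hz⟩ := hne
    exact hz (eq_self_of_eventually_fixed hη (hopen (mem_map.2 hfix)) z)

/-! ### Generators of the semicrossed product -/

theorem sumSpace_ext {ξ ζ : SumSpace} (h : ∀ x n, ξ x n = ζ x n) : ξ = ζ :=
  lp.ext (funext fun x => lp.ext (funext fun n => h x n))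

section

variable (η : C(Disc, Disc))

theorem sumRep_apply (f : C(Disc, ℂ)) (ξ : SumSpace) (x : Disc) (n : ℕ) :
    sumRep η f ξ x n = f (η^[n] x) * ξ x n := rfl

theorem sumShiftRep_apply_zero (g : C(Disc, ℂ)) (ξ : SumSpace) (x : Disc) :
    sumShiftRep η g ξ x 0 = 0 := rfl

theorem sumShiftRep_apply_succ (g : C(Disc, ℂ)) (ξ : SumSpace) (x : Disc) (n : ℕ) :
    sumShiftRep η g ξ x (n + 1) = g (η^[n] x) * ξ x n := rfl

theorem sumShiftRep_one_mul_sumRep (g : C(Disc, ℂ)) :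
    sumShiftRep η 1 * sumRep η g = sumShiftRep η g :=
  ContinuousLinearMap.ext fun ξ => sumSpace_ext fun x n => by
    cases n
    · simp [sumShiftRep_apply_zero]
    · simp [sumShiftRep_apply_succ, sumRep_apply]

theorem sumRep_mul_sumShiftRep_one (f : C(Disc, ℂ)) :
    sumRep η f * sumShiftRep η 1 = sumShiftRep η 1 * sumRep η (f.comp η) :=
  ContinuousLinearMap.ext fun ξ => sumSpace_ext fun x n => by
    cases n
    · simp [sumShiftRep_apply_zero, sumRep_apply]
    · simp [sumShiftRep_apply_succ, sumRep_apply, Function.iterate_succ_apply']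

theorem norm_sumRep_le (f : C(Disc, ℂ)) : ‖sumRep η f‖ ≤ ‖f‖ :=
  lp.norm_mapCLM_le _ _ _ _

theorem norm_forwardShift_apply (ξ : EllTwo) : ‖forwardShift ξ‖ = ‖ξ‖ := by
  have hsum := (lp.hasSum_norm (p := 2) (by norm_num) (forwardShift ξ)).unique (hasSum_shiftSeq ξ)
  exact (Real.rpow_left_inj (norm_nonneg _) (norm_nonneg _) (by norm_num)).1 hsum

theorem norm_sumShiftRep_one_apply (ξ : SumSpace) : ‖sumShiftRep η 1 ξ‖ = ‖ξ‖ := by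
  have hx : ∀ x, sumShiftRep η 1 ξ x = forwardShift (ξ x) := fun x =>
    lp.ext (funext fun n => by
      cases n
      · rfl
      · exact one_mul _)
  rw [lp.norm_eq_tsum_rpow (by norm_num), lp.norm_eq_tsum_rpow (by norm_num)]
  simp only [hx, norm_forwardShift_apply]

theorem norm_sumShiftRep_one_mul (b : SumSpace →L[ℂ] SumSpace) :
    ‖sumShiftRep η 1 * b‖ = ‖b‖ :=
  ContinuousLinearMap.opNorm_eq_of_bounds (norm_nonneg _)
    (fun ξ => (norm_sumShiftRep_one_apply η (b ξ)).trans_le (b.le_opNorm ξ))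
    (fun _ hM h => b.opNorm_le_bound hM fun ξ =>
      (norm_sumShiftRep_one_apply η (b ξ)).symm.trans_le (h ξ))

theorem sumRep_mem {f : C(Disc, ℂ)} (hf : f ∈ discAlgebra) : sumRep η f ∈ semicrossedProduct η :=
  Subalgebra.le_topologicalClosure _ (Algebra.subset_adjoin (Or.inl ⟨f, hf, rfl⟩))

theorem sumShiftRep_mem {f : C(Disc, ℂ)} (hf : f ∈ discAlgebra) :
    sumShiftRep η f ∈ semicrossedProduct η :=
  Subalgebra.le_topologicalClosure _ (Algebra.subset_adjoin (Or.inr ⟨f, hf, rfl⟩))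

theorem isClosed_semicrossedProduct :
    IsClosed (semicrossedProduct η : Set (SumSpace →L[ℂ] SumSpace)) :=
  Subalgebra.isClosed_topologicalClosure _

instance : CompleteSpace (semicrossedProduct η) :=
  (isClosed_semicrossedProduct η).completeSpace_coe

/-- The map `f ↦ ⨁ π_x(f)` as an algebra homomorphism. -/
def sumRepHom : C(Disc, ℂ) →ₐ[ℂ] (SumSpace →L[ℂ] SumSpace) where
  toFun := sumRep η
  map_one' := ContinuousLinearMap.ext fun ξ => sumSpace_ext fun x n => by
    simp [sumRep_apply]
  map_mul' f g := ContinuousLinearMap.ext fun ξ => sumSpace_ext fun x n => by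
    simp [sumRep_apply, mul_assoc]
  map_zero' := ContinuousLinearMap.ext fun ξ => sumSpace_ext fun x n => by
    simp [sumRep_apply]
  map_add' f g := ContinuousLinearMap.ext fun ξ => sumSpace_ext fun x n => by
    simp [sumRep_apply, add_mul]
  commutes' c := ContinuousLinearMap.ext fun ξ => sumSpace_ext fun x n => by
    simp [sumRep_apply, Algebra.algebraMap_eq_smul_one]

/-- The canonical homomorphism from the disc algebra to the semicrossed product. -/
def functionHom : discAlgebra →ₐ[ℂ] semicrossedProduct η :=
  ((sumRepHom η).comp discAlgebra.val).codRestrict _ fun f => sumRep_mem η f.2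

@[simp] theorem coe_functionHom (f : discAlgebra) :
    (functionHom η f : SumSpace →L[ℂ] SumSpace) = sumRep η f := rfl

/-- The shift `U = ⨁ U_x` as an element of the semicrossed product. -/
def shiftElem : semicrossedProduct η :=
  ⟨sumShiftRep η 1, sumShiftRep_mem η (one_mem _)⟩

@[simp] theorem coe_shiftElem : (shiftElem η : SumSpace →L[ℂ] SumSpace) = sumShiftRep η 1 := rfl

variable {η}

/-- The function `f ∘ η` as an element of the disc algebra. -/
def compDisc (hη : AnalyticInside fun z => (η z : ℂ)) (f : discAlgebra) : discAlgebra :=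
  ⟨(f : C(Disc, ℂ)).comp η, AnalyticInside.comp f.2 hη⟩

theorem functionHom_mul_shiftElem (hη : AnalyticInside fun z => (η z : ℂ)) (f : discAlgebra) :
    functionHom η f * shiftElem η = shiftElem η * functionHom η (compDisc hη f) :=
  Subtype.ext (sumRep_mul_sumShiftRep_one η f)

theorem eq_top_of_functionHom_mem_of_shiftElem_mem {S : Subalgebra ℂ (semicrossedProduct η)}
    (hclosed : IsClosed (S : Set (semicrossedProduct η))) (hfun : ∀ f, functionHom η f ∈ S)
    (hshift : shiftElem η ∈ S) : S = ⊤ := by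
  have hle : semicrossedProduct η ≤ S.map (semicrossedProduct η).val := by
    refine Subalgebra.topologicalClosure_minimal (Algebra.adjoin_le ?_)
      ((isClosed_semicrossedProduct η).isClosedEmbedding_subtypeVal.isClosedMap _ hclosed)
    rintro _ (⟨f, hf, rfl⟩ | ⟨f, hf, rfl⟩)
    · exact ⟨functionHom η ⟨f, hf⟩, hfun _, rfl⟩
    · exact ⟨shiftElem η * functionHom η ⟨f, hf⟩, mul_mem hshift (hfun _),
        sumShiftRep_one_mul_sumRep η f⟩
  refine Algebra.eq_top_iff.2 fun a => ?_
  obtain ⟨b, hb, hba⟩ := hle a.2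
  rwa [Subtype.ext hba] at hb

end

/-! ### Characters of the semicrossed product -/

/-- The unit vector at index `0` of the summand at `x`. -/
def vacuum (x : Disc) : SumSpace := by
  classical exact lp.single 2 x (lp.single 2 0 1)

@[simp] theorem vacuum_apply_zero (x : Disc) : vacuum x x 0 = 1 := by
  classical simp [vacuum]

theorem vacuum_apply_of_ne_zero (x : Disc) {n : ℕ} (hn : n ≠ 0) : vacuum x x n = 0 := by
  classical simp [vacuum, hn]

/-- The functional `ξ ↦ ∑ zⁿ ξ_x(n)`, an eigenvector of the transposed semicrossed product whenever
`z = 0` or `x` is a fixed point. -/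
def powerFunctional (x : Disc) (z : 𝔻) : SumSpace →L[ℂ] ℂ :=
  innerSL ℂ (⟨fun n => conj (z : ℂ) ^ n, memℓp_gen (by
    simpa [← pow_mul, mul_comm] using summable_geometric_of_lt_one (sq_nonneg ‖(z : ℂ)‖)
      (pow_lt_one₀ (norm_nonneg _) z.norm_lt_one two_ne_zero))⟩ : EllTwo) ∘L
    lp.evalCLM ℂ (fun _ : Disc => EllTwo) 2 x

theorem hasSum_powerFunctional (x : Disc) (z : 𝔻) (ξ : SumSpace) :
    HasSum (fun n => (z : ℂ) ^ n * ξ x n) (powerFunctional x z ξ) :=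
  (lp.hasSum_inner (𝕜 := ℂ) _ (ξ x)).congr_fun fun n => by simp [mul_comm]

@[simp] theorem powerFunctional_zero (x : Disc) (ξ : SumSpace) :
    powerFunctional x 0 ξ = ξ x 0 := by
  refine (hasSum_powerFunctional x 0 ξ).unique ?_
  simpa using hasSum_single (f := fun n => ((0 : 𝔻) : ℂ) ^ n * ξ x n) 0 (by simp +contextual)

@[simp] theorem powerFunctional_vacuum (x : Disc) (z : 𝔻) :
    powerFunctional x z (vacuum x) = 1 := by
  refine (hasSum_powerFunctional x z _).unique ?_
  simpa using hasSum_single (f := fun n => (z : ℂ) ^ n * vacuum x x n) 0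
    (fun n hn => by simp [vacuum_apply_of_ne_zero x hn])

section

variable {η : C(Disc, Disc)} {x : Disc} {z : 𝔻}

theorem powerFunctional_sumRep (h : z = 0 ∨ η x = x) (f : C(Disc, ℂ)) (ξ : SumSpace) :
    powerFunctional x z (sumRep η f ξ) = f x * powerFunctional x z ξ := by
  refine (hasSum_powerFunctional x z _).unique
    (((hasSum_powerFunctional x z ξ).mul_left (f x)).congr_fun fun n => ?_)
  rw [sumRep_apply]
  rcases h with rfl | h
  · cases n <;> simp
  · rw [Function.iterate_fixed h, mul_left_comm]

theorem powerFunctional_sumShiftRep_one (ξ : SumSpace) :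
    powerFunctional x z (sumShiftRep η 1 ξ) = z * powerFunctional x z ξ := by
  have hshift := (hasSum_nat_add_iff' 1).2 (hasSum_powerFunctional x z (sumShiftRep η 1 ξ))
  simp only [Finset.sum_range_one, sumShiftRep_apply_zero, mul_zero, sub_zero] at hshift
  refine hshift.unique (((hasSum_powerFunctional x z ξ).mul_left (z : ℂ)).congr_fun fun n => ?_)
  rw [sumShiftRep_apply_succ, ContinuousMap.one_apply, one_mul, pow_succ', mul_assoc]

theorem powerFunctional_apply (h : z = 0 ∨ η x = x) (a : semicrossedProduct η) (ξ : SumSpace) :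
    powerFunctional x z ((a : SumSpace →L[ℂ] SumSpace) ξ) =
      powerFunctional x z ((a : SumSpace →L[ℂ] SumSpace) (vacuum x)) * powerFunctional x z ξ := by
  let S : Subalgebra ℂ (semicrossedProduct η) :=
    { carrier := {a | ∀ ξ, powerFunctional x z ((a : SumSpace →L[ℂ] SumSpace) ξ) =
        powerFunctional x z ((a : SumSpace →L[ℂ] SumSpace) (vacuum x)) * powerFunctional x z ξ}
      mul_mem' := fun {a b} ha hb ξ => by
        simp only [MulMemClass.coe_mul, mul_apply_eq_comp]
        rw [ha, hb, ha ((b : SumSpace →L[ℂ] SumSpace) (vacuum x)), mul_assoc]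
      add_mem' := fun {a b} ha hb ξ => by
        simp only [AddMemClass.coe_add, add_apply, map_add]
        rw [ha, hb, add_mul]
      algebraMap_mem' := fun c ξ => by simp [Algebra.algebraMap_eq_smul_one] }
  have hclosed : IsClosed (S : Set (semicrossedProduct η)) := by
    simp only [S, Subalgebra.coe_mk, ofPred_forall]
    exact isClosed_iInter fun ξ => isClosed_eq (by fun_prop) (by fun_prop)
  have hS : S = ⊤ := eq_top_of_functionHom_mem_of_shiftElem_mem hclosed
    (fun f ξ => by simp [powerFunctional_sumRep h])
    (fun ξ => by simp [powerFunctional_sumShiftRep_one])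
  exact Algebra.eq_top_iff.1 hS a ξ

/-- The character `f ↦ f x`, `U ↦ z`. Covariance `f U = U (f ∘ η)` forces `z = 0` or `η x = x`. -/
def charAt (η : C(Disc, Disc)) (x : Disc) (z : 𝔻) (h : z = 0 ∨ η x = x) :
    semicrossedProduct η →ₐ[ℂ] ℂ where
  toFun a := powerFunctional x z ((a : SumSpace →L[ℂ] SumSpace) (vacuum x))
  map_one' := by simp
  map_mul' a b := powerFunctional_apply h a ((b : SumSpace →L[ℂ] SumSpace) (vacuum x))
  map_zero' := by simp
  map_add' a b := by simp
  commutes' c := by simp [Algebra.algebraMap_eq_smul_one]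

theorem hasSum_charAt (h : z = 0 ∨ η x = x) (a : semicrossedProduct η) :
    HasSum (fun n => (z : ℂ) ^ n * (a : SumSpace →L[ℂ] SumSpace) (vacuum x) x n)
      (charAt η x z h a) :=
  hasSum_powerFunctional x z _

@[simp] theorem charAt_functionHom (h : z = 0 ∨ η x = x) (f : discAlgebra) :
    charAt η x z h (functionHom η f) = (f : C(Disc, ℂ)) x :=
  (powerFunctional_sumRep h f (vacuum x)).trans (by simp)

@[simp] theorem charAt_shiftElem (h : z = 0 ∨ η x = x) : charAt η x z h (shiftElem η) = z :=
  (powerFunctional_sumShiftRep_one (vacuum x)).trans (by simp)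

end

/-- The character `f ↦ f x`, `U ↦ 0`, at the point `x` of the base disc. -/
def baseChar (η : C(Disc, Disc)) (x : Disc) : semicrossedProduct η →ₐ[ℂ] ℂ :=
  charAt η x 0 (Or.inl rfl)

@[simp] theorem baseChar_functionHom (η : C(Disc, Disc)) (x : Disc) (f : discAlgebra) :
    baseChar η x (functionHom η f) = (f : C(Disc, ℂ)) x :=
  charAt_functionHom _ f

@[simp] theorem baseChar_shiftElem (η : C(Disc, Disc)) (x : Disc) :
    baseChar η x (shiftElem η) = 0 :=
  charAt_shiftElem _

theorem baseChar_apply (η : C(Disc, Disc)) (x : Disc) (a : semicrossedProduct η) :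
    baseChar η x a = (a : SumSpace →L[ℂ] SumSpace) (vacuum x) x 0 :=
  powerFunctional_zero x _

instance : Nontrivial SumSpace :=
  ⟨vacuum ⟨0, by simp⟩, 0, fun h => by
    simpa using congrArg (fun ξ : SumSpace => ξ ⟨0, by simp⟩ 0) h⟩

/-! ### Expansion of elements of the semicrossed product -/

theorem norm_shiftElem_mul (η : C(Disc, Disc)) (b : semicrossedProduct η) :
    ‖shiftElem η * b‖ = ‖b‖ :=
  norm_sumShiftRep_one_mul η b

theorem norm_functionHom_le (η : C(Disc, Disc)) (f : discAlgebra) : ‖functionHom η f‖ ≤ ‖f‖ :=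
  norm_sumRep_le η f

theorem baseChar_functionHom_add (η : C(Disc, Disc)) (x : Disc) (f : discAlgebra)
    (b : semicrossedProduct η) :
    baseChar η x (functionHom η f + shiftElem η * b) = (f : C(Disc, ℂ)) x := by
  rw [map_add, map_mul, baseChar_functionHom, baseChar_shiftElem, zero_mul, add_zero]

theorem norm_le_norm_functionHom_add (η : C(Disc, Disc)) (f : discAlgebra)
    (b : semicrossedProduct η) : ‖f‖ ≤ ‖functionHom η f + shiftElem η * b‖ :=
  (ContinuousMap.norm_le _ (norm_nonneg _)).2 fun x =>
    baseChar_functionHom_add η x f b ▸ AlgHom.norm_apply_le_self (baseChar η x) _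

theorem norm_le_two_mul_norm_functionHom_add (η : C(Disc, Disc)) (f : discAlgebra)
    (b : semicrossedProduct η) : ‖b‖ ≤ 2 * ‖functionHom η f + shiftElem η * b‖ :=
  calc ‖b‖ = ‖functionHom η f + shiftElem η * b - functionHom η f‖ := by
        rw [add_sub_cancel_left, norm_shiftElem_mul]
    _ ≤ ‖functionHom η f + shiftElem η * b‖ + ‖functionHom η f‖ := norm_sub_le _ _
    _ ≤ ‖functionHom η f + shiftElem η * b‖ + ‖functionHom η f + shiftElem η * b‖ := by
        gcongr
        exact (norm_functionHom_le η f).trans (norm_le_norm_functionHom_add η f b)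
    _ = 2 * ‖functionHom η f + shiftElem η * b‖ := (two_mul _).symm

theorem isClosed_range_functionHom_add (η : C(Disc, Disc)) :
    IsClosed (range fun p : discAlgebra × semicrossedProduct η =>
      functionHom η p.1 + shiftElem η * p.2) := by
  let L : discAlgebra × semicrossedProduct η →ₗ[ℂ] semicrossedProduct η :=
    (functionHom η).toLinearMap.coprod (LinearMap.mulLeft ℂ (shiftElem η))
  have hanti : AntilipschitzWith 2 L := AddMonoidHomClass.antilipschitz_of_bound L fun p =>
    max_le ((norm_le_norm_functionHom_add η p.1 p.2).trans
      (le_mul_of_one_le_left (norm_nonneg _) one_le_two))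
      (norm_le_two_mul_norm_functionHom_add η p.1 p.2)
  have hfun : Continuous (functionHom η) :=
    AddMonoidHomClass.continuous_of_bound _ 1 fun f => by
      rw [one_mul]
      exact norm_functionHom_le η f
  have hL : Continuous L :=
    (hfun.comp continuous_fst).add (continuous_const.mul continuous_snd)
  exact hanti.isClosed_range (uniformContinuous_addMonoidHom_of_continuous hL)

theorem exists_eq_functionHom_add {η : C(Disc, Disc)} (hη : AnalyticInside fun z => (η z : ℂ))
    (a : semicrossedProduct η) :
    ∃ (f : discAlgebra) (b : semicrossedProduct η), functionHom η f + shiftElem η * b = a := by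
  let S : Subalgebra ℂ (semicrossedProduct η) :=
    { carrier := range fun p : discAlgebra × semicrossedProduct η =>
        functionHom η p.1 + shiftElem η * p.2
      mul_mem' := by
        rintro _ _ ⟨⟨f, b⟩, rfl⟩ ⟨⟨g, c⟩, rfl⟩
        refine ⟨(f * g, b * (functionHom η g + shiftElem η * c) +
          functionHom η (compDisc hη f) * c), ?_⟩
        simp only [map_mul]
        rw [add_mul, mul_add (functionHom η f), ← mul_assoc (functionHom η f),
          functionHom_mul_shiftElem hη]
        noncomm_ring
      add_mem' := by
        rintro _ _ ⟨⟨f, b⟩, rfl⟩ ⟨⟨g, c⟩, rfl⟩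
        exact ⟨(f + g, b + c), by simp only [map_add, mul_add]; abel⟩
      algebraMap_mem' := fun c => ⟨(algebraMap ℂ _ c, 0), by simp⟩ }
  have hS : S = ⊤ := eq_top_of_functionHom_mem_of_shiftElem_mem (isClosed_range_functionHom_add η)
    (fun f => ⟨(f, 0), by simp⟩) ⟨(0, 1), by simp⟩
  obtain ⟨⟨f, b⟩, hfb⟩ := Algebra.eq_top_iff.1 hS a
  exact ⟨f, b, hfb⟩

theorem exists_baseChar_eq {η : C(Disc, Disc)} (hη : AnalyticInside fun z => (η z : ℂ))
    (a : semicrossedProduct η) :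
    ∃ f : discAlgebra, ∀ x, baseChar η x a = (f : C(Disc, ℂ)) x := by
  obtain ⟨f, b, rfl⟩ := exists_eq_functionHom_add hη a
  exact ⟨f, fun x => baseChar_functionHom_add η x f b⟩

/-! ### Skew derivations -/

/-- Derivations of an algebra into the field of scalars, regarded as a bimodule with the left action
given by the character `φ` and the right action by the character `ψ`. -/
def IsSkewDerivation {A : Type*} [Ring A] [Algebra ℂ A] (φ ψ : A →ₐ[ℂ] ℂ) (D : A →ₗ[ℂ] ℂ) : Prop :=
  ∀ a b, D (a * b) = φ a * D b + D a * ψ b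

theorem IsSkewDerivation.comp {A B : Type*} [Ring A] [Algebra ℂ A] [Ring B] [Algebra ℂ B]
    {φ ψ : B →ₐ[ℂ] ℂ} {D : B →ₗ[ℂ] ℂ} (hD : IsSkewDerivation φ ψ D) (e : A →ₐ[ℂ] B) :
    IsSkewDerivation (φ.comp e) (ψ.comp e) (D ∘ₗ e.toLinearMap) := fun a b => by
  simp [hD (e a) (e b)]

/-- The coefficient `g x` of `U` in the Fourier series `a = f + U g + U² h + ⋯`. -/
def firstCoeff (η : C(Disc, Disc)) (x : Disc) : semicrossedProduct η →ₗ[ℂ] ℂ where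
  toFun a := (a : SumSpace →L[ℂ] SumSpace) (vacuum x) x 1
  map_add' _ _ := rfl
  map_smul' _ _ := rfl

theorem firstCoeff_functionHom_mul (η : C(Disc, Disc)) (x : Disc) (f : discAlgebra)
    (a : semicrossedProduct η) :
    firstCoeff η x (functionHom η f * a) = (f : C(Disc, ℂ)) (η x) * firstCoeff η x a :=
  sumRep_apply η f ((a : SumSpace →L[ℂ] SumSpace) (vacuum x)) x 1

theorem firstCoeff_shiftElem_mul (η : C(Disc, Disc)) (x : Disc) (a : semicrossedProduct η) :
    firstCoeff η x (shiftElem η * a) = baseChar η x a := by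
  rw [baseChar_apply]
  exact (sumShiftRep_apply_succ η 1 _ x 0).trans (one_mul _)

theorem firstCoeff_shiftElem (η : C(Disc, Disc)) (x : Disc) : firstCoeff η x (shiftElem η) = 1 := by
  simpa using firstCoeff_shiftElem_mul η x 1

theorem firstCoeff_functionHom (η : C(Disc, Disc)) (x : Disc) (f : discAlgebra) :
    firstCoeff η x (functionHom η f) = 0 := by
  have hone : firstCoeff η x 1 = 0 := vacuum_apply_of_ne_zero x one_ne_zero
  simpa [hone] using firstCoeff_functionHom_mul η x f 1

theorem isSkewDerivation_firstCoeff {η : C(Disc, Disc)} (hη : AnalyticInside fun z => (η z : ℂ))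
    (x : Disc) : IsSkewDerivation (baseChar η (η x)) (baseChar η x) (firstCoeff η x) := by
  intro a b
  obtain ⟨f, c, rfl⟩ := exists_eq_functionHom_add hη a
  rw [baseChar_functionHom_add, add_mul, mul_assoc, map_add, map_add, firstCoeff_functionHom_mul,
    firstCoeff_functionHom, firstCoeff_shiftElem_mul, firstCoeff_shiftElem_mul, zero_add, map_mul]

theorem IsSkewDerivation.exists_eq_mul_sub {η : C(Disc, Disc)}
    (hη : AnalyticInside fun z => (η z : ℂ)) {u y : Disc} {D : semicrossedProduct η →ₗ[ℂ] ℂ}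
    (hD : IsSkewDerivation (baseChar η u) (baseChar η y) D) (huy : u ≠ y) (huη : u ≠ η y) :
    ∃ c, ∀ a, D a = c * (baseChar η u a - baseChar η y a) := by
  have hfun : ∀ f : discAlgebra, D (functionHom η f) =
      D (functionHom η discId) / (u - y) * ((f : C(Disc, ℂ)) u - (f : C(Disc, ℂ)) y) := by
    intro f
    have huy' : (u : ℂ) - y ≠ 0 := sub_ne_zero.2 (Subtype.coe_ne_coe.2 huy)
    have hcomm : D (functionHom η f * functionHom η discId) =
        D (functionHom η discId * functionHom η f) := by
      rw [← map_mul, ← map_mul, mul_comm]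
    simp only [hD _ _, baseChar_functionHom, discId_apply] at hcomm
    field_simp
    linear_combination -hcomm
  have hshift : D (shiftElem η) = 0 := by
    have hcov : (u : ℂ) * D (shiftElem η) = D (shiftElem η) * (η y : ℂ) := by
      simpa [hD _ _, compDisc] using congrArg D (functionHom_mul_shiftElem hη discId)
    have hmul : ((u : ℂ) - η y) * D (shiftElem η) = 0 := by linear_combination hcov
    exact (mul_eq_zero.1 hmul).resolve_left (sub_ne_zero.2 (Subtype.coe_ne_coe.2 huη))
  refine ⟨D (functionHom η discId) / (u - y), fun a => ?_⟩
  obtain ⟨f, b, rfl⟩ := exists_eq_functionHom_add hη a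
  rw [map_add, hD, hshift, baseChar_shiftElem, hfun, baseChar_functionHom_add,
    baseChar_functionHom_add, zero_mul, zero_mul, add_zero, add_zero]

/-! ### The character space -/

section

variable {η : C(Disc, Disc)}

/-- The point of the disc over which a character of the semicrossed product lies. -/
def basePoint (φ : semicrossedProduct η →ₐ[ℂ] ℂ) : Disc :=
  ⟨φ (functionHom η discId), mem_closedBall_zero_iff.2 <|
    (AlgHom.norm_apply_le_self φ _).trans <| (norm_functionHom_le η _).trans norm_discId_le⟩

@[simp] theorem basePoint_charAt {x : Disc} {z : 𝔻} (h : z = 0 ∨ η x = x) :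
    basePoint (charAt η x z h) = x :=
  Subtype.ext (charAt_functionHom h discId)

@[simp] theorem basePoint_baseChar (x : Disc) : basePoint (baseChar η x) = x :=
  basePoint_charAt _

theorem algHom_functionHom (φ : semicrossedProduct η →ₐ[ℂ] ℂ) (f : discAlgebra) :
    φ (functionHom η f) = (f : C(Disc, ℂ)) (basePoint φ) :=
  algHom_discAlgebra_apply (φ.comp (functionHom η)) rfl f

theorem apply_basePoint_of_algHom_shiftElem_ne_zero (hη : AnalyticInside fun z => (η z : ℂ))
    {φ : semicrossedProduct η →ₐ[ℂ] ℂ} (hφ : φ (shiftElem η) ≠ 0) :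
    η (basePoint φ) = basePoint φ := by
  have hcov := congrArg φ (functionHom_mul_shiftElem hη discId)
  rw [map_mul, map_mul, algHom_functionHom, algHom_functionHom, mul_comm] at hcov
  exact Subtype.ext (mul_left_cancel₀ hφ hcov).symm

theorem algHom_ext {φ ψ : semicrossedProduct η →ₐ[ℂ] ℂ} (hbase : basePoint φ = basePoint ψ)
    (hshift : φ (shiftElem η) = ψ (shiftElem η)) : φ = ψ := by
  have htop : AlgHom.equalizer φ ψ = ⊤ := eq_top_of_functionHom_mem_of_shiftElem_mem
    (isClosed_eq (map_continuous φ) (map_continuous ψ))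
    (fun f => by rw [AlgHom.mem_equalizer, algHom_functionHom, algHom_functionHom, hbase]) hshift
  exact AlgHom.ext fun a => Algebra.eq_top_iff.1 htop a

theorem eq_baseChar_basePoint {φ : semicrossedProduct η →ₐ[ℂ] ℂ} (hφ : φ (shiftElem η) = 0) :
    φ = baseChar η (basePoint φ) :=
  algHom_ext (basePoint_baseChar _).symm (hφ.trans (baseChar_shiftElem _ _).symm)

end

/-! ### The commutative case -/

theorem eq_self_of_commute {η : C(Disc, Disc)}
    (hcomm : Commute (functionHom η discId) (shiftElem η)) (x : Disc) : η x = x := by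
  have hcoeff := congrArg (firstCoeff η x) hcomm.eq
  rw [firstCoeff_functionHom_mul, firstCoeff_shiftElem, firstCoeff_shiftElem_mul,
    baseChar_functionHom, mul_one] at hcoeff
  exact Subtype.ext hcoeff

theorem commute_of_commute_generators {η : C(Disc, Disc)} {a : semicrossedProduct η}
    (hfun : ∀ f, Commute a (functionHom η f)) (hshift : Commute a (shiftElem η))
    (b : semicrossedProduct η) : Commute a b := by
  have htop : Subalgebra.centralizer ℂ {a} = ⊤ :=
    eq_top_of_functionHom_mem_of_shiftElem_mem (isClosed_centralizer {a})
      (fun f => (Subalgebra.mem_centralizer_iff ℂ).2 (by rintro _ rfl; exact hfun f))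
      ((Subalgebra.mem_centralizer_iff ℂ).2 (by rintro _ rfl; exact hshift))
  exact (Subalgebra.mem_centralizer_iff ℂ).1 (Algebra.eq_top_iff.1 htop b) a rfl

theorem commute_of_forall_apply_eq {η : C(Disc, Disc)} (hη : ∀ x, η x = x)
    (a b : semicrossedProduct η) : Commute a b := by
  have hfun : ∀ f g, Commute (functionHom η f) (functionHom η g) := fun f g =>
    (Commute.all f g).map (functionHom η)
  have hshift : ∀ f, Commute (functionHom η f) (shiftElem η) := fun f => Subtype.ext <| by
    have hcomp : (f : C(Disc, ℂ)).comp η = f := ContinuousMap.ext fun x => congrArg _ (hη x)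
    simpa [hcomp] using sumRep_mul_sumShiftRep_one η f
  exact commute_of_commute_generators
    (fun f => (commute_of_commute_generators (hfun f) (hshift f) a).symm)
    (commute_of_commute_generators (fun f => (hshift f).symm) (Commute.refl _) a).symm b

/-! ### Analytic discs of characters -/

section

variable {A B : Type*} [Ring A] [Algebra ℂ A] [Ring B] [Algebra ℂ B]

/-- A family of characters of an algebra, indexed by the open unit disc, that depends analytically
on the parameter. -/
def IsAnalyticDisc (Φ : 𝔻 → A →ₐ[ℂ] ℂ) : Prop :=
  ∀ a, ∃ F : ℂ → ℂ, AnalyticOnNhd ℂ F (ball 0 1) ∧ ∀ ζ : 𝔻, Φ ζ a = F ζ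

theorem IsAnalyticDisc.comp {Φ : 𝔻 → B →ₐ[ℂ] ℂ} (hΦ : IsAnalyticDisc Φ) (e : A →ₐ[ℂ] B) :
    IsAnalyticDisc fun ζ => (Φ ζ).comp e :=
  fun a => hΦ (e a)

theorem IsAnalyticDisc.range_mem_nhds {Φ : 𝔻 → A →ₐ[ℂ] ℂ} (hΦ : IsAnalyticDisc Φ) {a : A}
    (hinj : Function.Injective fun ζ => Φ ζ a) : range (fun ζ => Φ ζ a) ∈ 𝓝 (Φ 0 a) := by
  obtain ⟨F, hF, hΦF⟩ := hΦ a
  simp only [hΦF] at hinj ⊢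
  have himage : F '' ball 0 1 = range fun ζ : 𝔻 => F ζ := by
    rw [image_eq_range]
    rfl
  have hopen : IsOpen (F '' ball 0 1) := by
    refine ((hF.is_constant_or_isOpen isPreconnected_unitBall).resolve_left ?_) _ subset_rfl
      isOpen_ball
    rintro ⟨c, hc⟩
    have hnorm : ‖(1 / 2 : ℂ)‖ < 1 := by norm_num
    have hhalf : Complex.UnitDisc.mk (1 / 2) hnorm = 0 :=
      hinj ((hc _ (mem_ball_zero_iff.2 hnorm)).trans (hc 0 (mem_ball_self one_pos)).symm)
    simpa using congrArg Complex.UnitDisc.coe hhalf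
  rw [← himage]
  exact hopen.mem_nhds (mem_image_of_mem F (mem_ball_self one_pos))

end

/-- The inclusion of the open unit disc into the closed one. -/
def ofUnitDisc (ζ : 𝔻) : Disc := ⟨ζ, ball_subset_closedBall ζ.2⟩

theorem exists_ofUnitDisc_eq {z : Disc} (hz : (z : ℂ) ∈ ball (0 : ℂ) 1) : ∃ ζ, ofUnitDisc ζ = z :=
  ⟨⟨z, hz⟩, rfl⟩

section

variable {η : C(Disc, Disc)}

theorem isAnalyticDisc_baseChar (hη : AnalyticInside fun z => (η z : ℂ)) :
    IsAnalyticDisc fun ζ => baseChar η (ofUnitDisc ζ) := fun a => by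
  obtain ⟨f, hf⟩ := exists_baseChar_eq hη a
  obtain ⟨F, hF, hfF⟩ := f.2
  exact ⟨F, hF, fun ζ => (hf _).trans (hfF (ofUnitDisc ζ) ζ.2)⟩

theorem isAnalyticDisc_charAt {v : Disc} (hv : η v = v) :
    IsAnalyticDisc fun ζ => charAt η v ζ (Or.inr hv) := fun a => by
  set c := (a : SumSpace →L[ℂ] SumSpace) (vacuum v) v
  refine ⟨fun z => ∑' n, z ^ n * c n, DifferentiableOn.analyticOnNhd (fun z hz => ?_) isOpen_ball,
    fun ζ => (hasSum_charAt _ a).tsum_eq.symm⟩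
  obtain ⟨r, hzr, hr⟩ := exists_between (mem_ball_zero_iff.1 hz)
  have hr0 : 0 ≤ r := (norm_nonneg z).trans hzr.le
  have hdiff : DifferentiableOn ℂ (fun w : ℂ => ∑' n, w ^ n * c n) (ball 0 r) := by
    refine Complex.differentiableOn_tsum_of_summable_norm (u := fun n => r ^ n * ‖c‖)
      ((summable_geometric_of_lt_one hr0 hr).mul_right _)
      (fun n => by fun_prop) isOpen_ball fun n w hw => ?_
    rw [norm_mul, norm_pow]
    gcongr
    · exact (mem_ball_zero_iff.1 hw).le
    · exact lp.norm_apply_le_norm two_ne_zero c n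
  exact (hdiff.differentiableAt
    (isOpen_ball.mem_nhds (mem_ball_zero_iff.2 hzr))).differentiableWithinAt

theorem injective_charAt {v : Disc} (hv : η v = v) :
    Function.Injective fun ζ => charAt η v ζ (Or.inr hv) := fun ζ ζ' h => by
  simpa using DFunLike.congr_fun h (shiftElem η)

variable {Φ : 𝔻 → semicrossedProduct η →ₐ[ℂ] ℂ}

theorem IsAnalyticDisc.shiftElem_eq_zero_or_basePoint_eq (hΦ : IsAnalyticDisc Φ)
    (hη : AnalyticInside fun z => (η z : ℂ)) (hne : ∃ z, η z ≠ z) :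
    (∀ ζ, Φ ζ (shiftElem η) = 0) ∨ ∃ w, η w = w ∧ ∀ ζ, basePoint (Φ ζ) = w := by
  obtain ⟨p, hp, hΦp⟩ := hΦ (functionHom η discId)
  obtain ⟨q, hq, hΦq⟩ := hΦ (shiftElem η)
  refine (eqOn_zero_or_exists_fixed hη hne hp hq fun z hz hqz => ?_).imp
    (fun hzero ζ => (hΦq ζ).trans (hzero ζ.2))
    (fun ⟨w, hw, hconst⟩ => ⟨w, hw, fun ζ => Subtype.ext ((hΦp ζ).trans (hconst ζ ζ.2))⟩)
  lift z to 𝔻 using mem_ball_zero_iff.1 hz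
  exact ⟨basePoint (Φ z), hΦp z, apply_basePoint_of_algHom_shiftElem_ne_zero hη (hΦq z ▸ hqz)⟩

theorem IsAnalyticDisc.range_shiftElem_mem_nhds (hΦ : IsAnalyticDisc Φ)
    (hinj : Function.Injective Φ) {w : Disc} (hbase : ∀ ζ, basePoint (Φ ζ) = w) :
    range (fun ζ => Φ ζ (shiftElem η)) ∈ 𝓝 (Φ 0 (shiftElem η)) :=
  hΦ.range_mem_nhds fun ζ ζ' h => hinj (algHom_ext ((hbase ζ).trans (hbase ζ').symm) h)

theorem IsAnalyticDisc.basePoint_mem_ball (hΦ : IsAnalyticDisc Φ) (hinj : Function.Injective Φ)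
    (hshift : ∀ ζ, Φ ζ (shiftElem η) = 0) : (basePoint (Φ 0) : ℂ) ∈ ball (0 : ℂ) 1 := by
  rw [← interior_closedBall _ one_ne_zero, mem_interior_iff_mem_nhds]
  refine mem_of_superset (hΦ.range_mem_nhds (a := functionHom η discId) fun ζ ζ' h =>
    hinj (algHom_ext (Subtype.ext h) ((hshift ζ).trans (hshift ζ').symm))) ?_
  rintro _ ⟨ζ, rfl⟩
  exact (basePoint (Φ ζ)).2

end

/-! ### Isomorphisms that preserve the base disc -/

section

variable {η θ : C(Disc, Disc)}

/-- The map induced by a homomorphism `e` on base points: the character of the base disc at `x` is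
pulled back along `e` to a character over `baseMap e x`. -/
def baseMap (e : semicrossedProduct η →ₐ[ℂ] semicrossedProduct θ) (x : Disc) : Disc :=
  basePoint ((baseChar θ x).comp e)

/-- The homomorphism `e` pulls the characters of the base disc back to characters of the base
disc. -/
def PreservesBase (e : semicrossedProduct η →ₐ[ℂ] semicrossedProduct θ) : Prop :=
  ∀ x, baseChar θ x (e (shiftElem η)) = 0

theorem PreservesBase.baseChar_comp {e : semicrossedProduct η →ₐ[ℂ] semicrossedProduct θ}
    (he : PreservesBase e) (x : Disc) : (baseChar θ x).comp e = baseChar η (baseMap e x) :=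
  eq_baseChar_basePoint (he x)

theorem exists_baseMap_eq (hθ : AnalyticInside fun z => (θ z : ℂ))
    (e : semicrossedProduct η →ₐ[ℂ] semicrossedProduct θ) :
    ∃ f : discAlgebra, ∀ x, (baseMap e x : ℂ) = (f : C(Disc, ℂ)) x :=
  exists_baseChar_eq hθ (e (functionHom η discId))

theorem continuous_baseMap (hθ : AnalyticInside fun z => (θ z : ℂ))
    (e : semicrossedProduct η →ₐ[ℂ] semicrossedProduct θ) : Continuous (baseMap e) := by
  obtain ⟨f, hf⟩ := exists_baseMap_eq hθ e
  exact continuous_induced_rng.2 ((f : C(Disc, ℂ)).continuous.congr fun x => (hf x).symm)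

theorem analyticInside_baseMap (hθ : AnalyticInside fun z => (θ z : ℂ))
    (e : semicrossedProduct η →ₐ[ℂ] semicrossedProduct θ) :
    AnalyticInside fun x => (baseMap e x : ℂ) := by
  obtain ⟨f, hf⟩ := exists_baseMap_eq hθ e
  rw [funext hf]
  exact f.2

theorem continuous_baseChar_apply (hη : AnalyticInside fun z => (η z : ℂ))
    (a : semicrossedProduct η) : Continuous fun x => baseChar η x a := by
  obtain ⟨f, hf⟩ := exists_baseChar_eq hη a
  exact (f : C(Disc, ℂ)).continuous.congr fun x => (hf x).symm

theorem preservesBase_or_baseMap_eq_const (hη : AnalyticInside fun z => (η z : ℂ))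
    (hθ : AnalyticInside fun z => (θ z : ℂ)) (hne : ∃ z, η z ≠ z)
    (e : semicrossedProduct η →ₐ[ℂ] semicrossedProduct θ) :
    PreservesBase e ∨ ∃ w, η w = w ∧ ∀ x, baseMap e x = w := by
  refine (((isAnalyticDisc_baseChar hθ).comp e).shiftElem_eq_zero_or_basePoint_eq hη hne).imp
    (fun hzero => ?_) (fun ⟨w, hw, hconst⟩ => ⟨w, hw, ?_⟩)
  · refine congrFun (eq_of_eqOn_openDisc (continuous_baseChar_apply hθ _) continuous_const
      fun x hx => ?_)
    obtain ⟨ζ, rfl⟩ := exists_ofUnitDisc_eq hx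
    exact hzero ζ
  · refine congrFun (eq_of_eqOn_openDisc (continuous_baseMap hθ e) continuous_const
      fun x hx => ?_)
    obtain ⟨ζ, rfl⟩ := exists_ofUnitDisc_eq hx
    exact hconst ζ

theorem comp_injective (e : semicrossedProduct η ≃ₐ[ℂ] semicrossedProduct θ) :
    Function.Injective fun φ : semicrossedProduct θ →ₐ[ℂ] ℂ => φ.comp e.toAlgHom :=
  fun _ _ h => AlgHom.cancel_right e.surjective |>.1 h

theorem PreservesBase.baseMap_symm_baseMap
    {e : semicrossedProduct η ≃ₐ[ℂ] semicrossedProduct θ} (he : PreservesBase e.toAlgHom)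
    (x : Disc) : baseMap e.symm.toAlgHom (baseMap e.toAlgHom x) = x := by
  rw [baseMap, ← he.baseChar_comp, AlgHom.comp_assoc]
  simp

theorem PreservesBase.symm (hη : AnalyticInside fun z => (η z : ℂ))
    (hθ : AnalyticInside fun z => (θ z : ℂ)) (hne : ∃ z, θ z ≠ z)
    {e : semicrossedProduct η ≃ₐ[ℂ] semicrossedProduct θ} (he : PreservesBase e.toAlgHom) :
    PreservesBase e.symm.toAlgHom := by
  refine (preservesBase_or_baseMap_eq_const hθ hη hne e.symm.toAlgHom).resolve_right ?_
  rintro ⟨w, -, hconst⟩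
  obtain ⟨x, hx⟩ := exists_ne w
  exact hx ((he.baseMap_symm_baseMap x).symm.trans (hconst _))

/-! ### Collapse of the base disc forces ellipticity -/

theorem not_forall_basePoint_charAt_comp_eq (hθ : AnalyticInside fun z => (θ z : ℂ))
    (e : semicrossedProduct η ≃ₐ[ℂ] semicrossedProduct θ) {v w : Disc} (hv : θ v = v)
    (hbase : ∀ x, baseMap e.toAlgHom x = w) :
    ¬ ∀ ζ, basePoint ((charAt θ v ζ (Or.inr hv)).comp e.toAlgHom) = w := by
  intro hfibre
  -- The fibre over `v` fills a neighbourhood inside the fibre over `w`, which the base disc meets.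
  have hnhds := ((isAnalyticDisc_charAt hv).comp e.toAlgHom).range_shiftElem_mem_nhds
    ((comp_injective e).comp (injective_charAt hv)) hfibre
  have hnear : ∀ᶠ x in 𝓝 v, baseChar θ x (e (shiftElem η)) ∈
      range fun ζ => charAt θ v ζ (Or.inr hv) (e (shiftElem η)) :=
    (continuous_baseChar_apply hθ _).continuousAt.eventually hnhds
  obtain ⟨x, ⟨ζ, hζ⟩, hxv⟩ := (hnear.filter_mono nhdsWithin_le_nhds).and
    (self_mem_nhdsWithin (s := {v}ᶜ)) |>.exists
  have hchar : charAt θ v ζ (Or.inr hv) = baseChar θ x :=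
    comp_injective e (algHom_ext ((hfibre ζ).trans (hbase x).symm) hζ)
  exact hxv (by simpa using congrArg basePoint hchar.symm)

theorem charAt_shiftElem_eq_zero_of_baseMap_eq_const (hη : AnalyticInside fun z => (η z : ℂ))
    (hθ : AnalyticInside fun z => (θ z : ℂ)) (hne : ∃ z, η z ≠ z)
    (e : semicrossedProduct η ≃ₐ[ℂ] semicrossedProduct θ) {v w : Disc} (hv : θ v = v)
    (hbase : ∀ x, baseMap e.toAlgHom x = w) (ζ : 𝔻) :
    charAt θ v ζ (Or.inr hv) (e (shiftElem η)) = 0 := by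
  refine (((isAnalyticDisc_charAt hv).comp e.toAlgHom).shiftElem_eq_zero_or_basePoint_eq hη
    hne).resolve_right ?_ ζ
  rintro ⟨w', -, hfibre⟩
  obtain rfl : w' = w := (hfibre 0).symm.trans (hbase v)
  exact not_forall_basePoint_charAt_comp_eq hθ e hv hbase hfibre

theorem isElliptic_of_baseMap_eq_const (hη : AnalyticInside fun z => (η z : ℂ))
    (hθ : AnalyticInside fun z => (θ z : ℂ)) (hneη : ∃ z, η z ≠ z) (hneθ : ∃ z, θ z ≠ z)
    (e : semicrossedProduct η ≃ₐ[ℂ] semicrossedProduct θ) {w w' : Disc} (hw : η w = w)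
    (hw' : θ w' = w') (hbase : ∀ x, baseMap e.toAlgHom x = w)
    (hbase' : ∀ x, baseMap e.symm.toAlgHom x = w') : IsElliptic θ := by
  refine ⟨w', ?_, fun v => ⟨fun hv => ?_, fun hv => hv ▸ hw'⟩⟩
  · have hmem := ((isAnalyticDisc_charAt hw).comp e.symm.toAlgHom).basePoint_mem_ball
      ((comp_injective e.symm).comp (injective_charAt hw))
      (charAt_shiftElem_eq_zero_of_baseMap_eq_const hθ hη hneθ e.symm hw hbase')
    rwa [← hbase' w]
  · have hchar : (baseChar θ v).comp e.toAlgHom = baseChar η (baseMap e.toAlgHom v) :=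
      eq_baseChar_basePoint
        (charAt_shiftElem_eq_zero_of_baseMap_eq_const hη hθ hneη e hv hbase 0)
    rw [← hbase' (baseMap e.toAlgHom v), baseMap, ← hchar, AlgHom.comp_assoc]
    simp

theorem preservesBase_of_not_isElliptic (hη : AnalyticInside fun z => (η z : ℂ))
    (hθ : AnalyticInside fun z => (θ z : ℂ)) (hneη : ∃ z, η z ≠ z) (hneθ : ∃ z, θ z ≠ z)
    (hell : ¬ (IsElliptic η ∧ IsElliptic θ))
    (e : semicrossedProduct η ≃ₐ[ℂ] semicrossedProduct θ) : PreservesBase e.toAlgHom := by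
  refine (preservesBase_or_baseMap_eq_const hη hθ hneη e.toAlgHom).resolve_right ?_
  rintro ⟨w, hw, hbase⟩
  rcases preservesBase_or_baseMap_eq_const hθ hη hneθ e.symm.toAlgHom with
    hpres | ⟨w', hw', hbase'⟩
  · obtain ⟨x, hx⟩ := exists_ne w
    exact hx ((hpres.baseMap_symm_baseMap x).symm.trans (hbase _))
  · exact hell ⟨isElliptic_of_baseMap_eq_const hθ hη hneθ hneη e.symm hw' hw hbase' hbase,
      isElliptic_of_baseMap_eq_const hη hθ hneη hneθ e hw hw' hbase hbase'⟩

/-! ### Conjugacy from an isomorphism -/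

theorem PreservesBase.baseMap_apply (hη : AnalyticInside fun z => (η z : ℂ))
    (hθ : AnalyticInside fun z => (θ z : ℂ))
    {e : semicrossedProduct η ≃ₐ[ℂ] semicrossedProduct θ} (he : PreservesBase e.toAlgHom)
    {x : Disc} (hx : θ x ≠ x) : baseMap e.toAlgHom (θ x) = η (baseMap e.toAlgHom x) := by
  by_contra hne
  have hD := (isSkewDerivation_firstCoeff hθ x).comp e.toAlgHom
  rw [he.baseChar_comp, he.baseChar_comp] at hD
  have hinj : Function.Injective (baseMap e.toAlgHom) :=
    Function.LeftInverse.injective he.baseMap_symm_baseMap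
  obtain ⟨c, hc⟩ := hD.exists_eq_mul_sub hη (hinj.ne hx) hne
  have hshift := hc (e.symm (shiftElem θ))
  rw [← he.baseChar_comp, ← he.baseChar_comp] at hshift
  simp [firstCoeff_shiftElem] at hshift

/-- The homeomorphism of the disc induced by an isomorphism that preserves the base disc in both
directions. -/
def baseHomeomorph (hη : AnalyticInside fun z => (η z : ℂ))
    (hθ : AnalyticInside fun z => (θ z : ℂ)) {e : semicrossedProduct η ≃ₐ[ℂ] semicrossedProduct θ}
    (he : PreservesBase e.toAlgHom) (he' : PreservesBase e.symm.toAlgHom) : Disc ≃ₜ Disc where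
  toFun := baseMap e.toAlgHom
  invFun := baseMap e.symm.toAlgHom
  left_inv := he.baseMap_symm_baseMap
  right_inv := he'.baseMap_symm_baseMap
  continuous_toFun := continuous_baseMap hθ _
  continuous_invFun := continuous_baseMap hη _

theorem forall_apply_eq_of_algEquiv (e : semicrossedProduct η ≃ₐ[ℂ] semicrossedProduct θ)
    (hη : ∀ z, η z = z) (z : Disc) : θ z = z :=
  eq_self_of_commute ((commute_of_forall_apply_eq hη _ _).of_map e.symm.injective) z

theorem exists_conj_of_algEquiv (hη : AnalyticInside fun z => (η z : ℂ))
    (hθ : AnalyticInside fun z => (θ z : ℂ)) (hell : ¬ (IsElliptic η ∧ IsElliptic θ))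
    (e : semicrossedProduct η ≃ₐ[ℂ] semicrossedProduct θ) :
    ∃ γ : Disc ≃ₜ Disc, AnalyticInside (fun z => (γ z : ℂ)) ∧ ⇑γ ∘ ⇑θ = ⇑η ∘ ⇑γ := by
  by_cases hid : ∀ z, η z = z
  · refine ⟨Homeomorph.refl _, discId.2, funext fun z => ?_⟩
    simp [hid, forall_apply_eq_of_algEquiv e hid]
  have hneη : ∃ z, η z ≠ z := not_forall.1 hid
  have hneθ : ∃ z, θ z ≠ z :=
    not_forall.1 fun hθid => hid (forall_apply_eq_of_algEquiv e.symm hθid)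
  have he := preservesBase_of_not_isElliptic hη hθ hneη hneθ hell e
  refine ⟨baseHomeomorph hη hθ he (he.symm hη hθ hneθ), analyticInside_baseMap hθ _, ?_⟩
  exact Continuous.ext_on (dense_not_fixed hθ hneθ)
    ((continuous_baseMap hθ e.toAlgHom).comp θ.continuous)
    (η.continuous.comp (continuous_baseMap hθ e.toAlgHom)) fun x hx => he.baseMap_apply hη hθ hx

end

/-! ### Isomorphisms from conjugacies -/

theorem hasSum_norm_sq_comp (σ : Disc ≃ Disc) (ξ : SumSpace) :
    HasSum (fun x => ‖ξ (σ x)‖ ^ (2 : ℝ≥0∞).toReal) (‖ξ‖ ^ (2 : ℝ≥0∞).toReal) :=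
  σ.hasSum_iff.2 (lp.hasSum_norm (p := 2) (by norm_num) ξ)

/-- The operator on `⨁ ℓ²(ℕ)` that permutes the summands: the summand of `permute σ ξ` at `x` is
the summand of `ξ` at `σ x`. -/
def permute (σ : Disc ≃ Disc) : SumSpace →L[ℂ] SumSpace :=
  LinearMap.mkContinuous
    { toFun := fun ξ => ⟨fun x => ξ (σ x), memℓp_gen (hasSum_norm_sq_comp σ ξ).summable⟩
      map_add' := fun _ _ => rfl
      map_smul' := fun _ _ => rfl }
    1 (fun ξ => lp.norm_le_of_tsum_le (by norm_num) (by positivity) (by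
      rw [one_mul]
      exact (hasSum_norm_sq_comp σ ξ).tsum_eq.le))

theorem permute_apply (σ : Disc ≃ Disc) (ξ : SumSpace) (x : Disc) : permute σ ξ x = ξ (σ x) :=
  rfl

/-- Conjugation by the permutation `permute σ` of the summands, as an automorphism of the algebra
of all operators. -/
def permuteConj (σ : Disc ≃ Disc) : (SumSpace →L[ℂ] SumSpace) ≃A[ℂ] (SumSpace →L[ℂ] SumSpace) :=
  (ContinuousLinearEquiv.equivOfInverse (permute σ) (permute σ.symm)
    (fun ξ => sumSpace_ext fun x n => by simp [permute_apply])
    (fun ξ => sumSpace_ext fun x n => by simp [permute_apply])).conjContinuousAlgEquiv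

theorem permuteConj_apply (σ : Disc ≃ Disc) (a : SumSpace →L[ℂ] SumSpace) (ξ : SumSpace)
    (x : Disc) : permuteConj σ a ξ x = a (permute σ.symm ξ) (σ x) :=
  rfl

theorem permuteConj_symm_permuteConj (σ : Disc ≃ Disc) (a : SumSpace →L[ℂ] SumSpace) :
    permuteConj σ.symm (permuteConj σ a) = a := by
  have hsymm : ∀ ξ : SumSpace, permute σ.symm (permute σ ξ) = ξ := fun ξ =>
    sumSpace_ext fun x n => by simp [permute_apply]
  exact ContinuousLinearMap.ext fun ξ => sumSpace_ext fun x n => by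
    simp [permuteConj_apply, hsymm]

variable {η θ : C(Disc, Disc)} {γ : Disc ≃ₜ Disc}

theorem permuteConj_sumRep (h : Function.Semiconj γ θ η) (f : C(Disc, ℂ)) :
    permuteConj γ.toEquiv (sumRep η f) = sumRep θ (f.comp (γ : C(Disc, Disc))) :=
  ContinuousLinearMap.ext fun ξ => sumSpace_ext fun x n => by
    simp [permuteConj_apply, permute_apply, sumRep_apply, (h.iterate_right n x).symm]

theorem permuteConj_sumShiftRep (h : Function.Semiconj γ θ η) (f : C(Disc, ℂ)) :
    permuteConj γ.toEquiv (sumShiftRep η f) = sumShiftRep θ (f.comp (γ : C(Disc, Disc))) :=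
  ContinuousLinearMap.ext fun ξ => sumSpace_ext fun x n => by
    cases n with
    | zero => rfl
    | succ n =>
      simp [permuteConj_apply, permute_apply, sumShiftRep_apply_succ, (h.iterate_right n x).symm]

theorem permuteConj_mem (hγ : AnalyticInside fun z => (γ z : ℂ)) (h : Function.Semiconj γ θ η)
    {a : SumSpace →L[ℂ] SumSpace} (ha : a ∈ semicrossedProduct η) :
    permuteConj γ.toEquiv a ∈ semicrossedProduct θ := by
  suffices hle : semicrossedProduct η ≤
      (semicrossedProduct θ).comap (permuteConj γ.toEquiv).toAlgEquiv.toAlgHom from hle ha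
  refine Subalgebra.topologicalClosure_minimal (Algebra.adjoin_le ?_)
    ((isClosed_semicrossedProduct θ).preimage (permuteConj γ.toEquiv).continuous)
  rintro _ (⟨f, hf, rfl⟩ | ⟨f, hf, rfl⟩)
  · change permuteConj γ.toEquiv (sumRep η f) ∈ semicrossedProduct θ
    rw [permuteConj_sumRep h]
    exact sumRep_mem θ (comp_mem_discAlgebra hf hγ)
  · change permuteConj γ.toEquiv (sumShiftRep η f) ∈ semicrossedProduct θ
    rw [permuteConj_sumShiftRep h]
    exact sumShiftRep_mem θ (comp_mem_discAlgebra hf hγ)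

theorem nonempty_algEquiv_of_conj (hγ : AnalyticInside fun z => (γ z : ℂ))
    (h : ⇑γ ∘ ⇑η = ⇑θ ∘ ⇑γ) :
    Nonempty (semicrossedProduct η ≃ₐ[ℂ] semicrossedProduct θ) := by
  have hsemi : Function.Semiconj γ η θ := congrFun h
  have hsemi' : Function.Semiconj γ.symm θ η :=
    hsemi.inverse_left γ.symm_apply_apply γ.apply_symm_apply
  exact ⟨AlgEquiv.ofAlgHom
    (((permuteConj γ.symm.toEquiv).toAlgEquiv.toAlgHom.comp
      (semicrossedProduct η).val).codRestrict _
      fun a => permuteConj_mem hγ.homeomorph_symm hsemi' a.2)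
    (((permuteConj γ.toEquiv).toAlgEquiv.toAlgHom.comp
      (semicrossedProduct θ).val).codRestrict _ fun a => permuteConj_mem hγ hsemi a.2)
    (AlgHom.ext fun a => Subtype.ext (permuteConj_symm_permuteConj γ.toEquiv a))
    (AlgHom.ext fun a => Subtype.ext (permuteConj_symm_permuteConj γ.symm.toEquiv a))⟩

end DiscSemicrossed

end

open DiscSemicrossed in
theorem mainTheorem7_general (η₁ η₂ : C(Disc, Disc))
    (hη₁ : AnalyticInside (fun z => (η₁ z : ℂ))) (hη₂ : AnalyticInside (fun z => (η₂ z : ℂ)))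
    (hell : ¬ (IsElliptic η₁ ∧ IsElliptic η₂)) :
    Nonempty (semicrossedProduct η₁ ≃ₐ[ℂ] semicrossedProduct η₂) ↔
      ∃ γ : Disc ≃ₜ Disc, AnalyticInside (fun z => (γ z : ℂ)) ∧ ⇑γ ∘ ⇑η₁ = ⇑η₂ ∘ ⇑γ :=
  ⟨fun ⟨Φ⟩ => exists_conj_of_algEquiv hη₂ hη₁ (fun h => hell h.symm) Φ.symm,
    fun ⟨_, hγ, h⟩ => nonempty_algEquiv_of_conj hγ h⟩

open DiscSemicrossed in
theorem mainTheorem7 (η₁ η₂ : C(Disc, Disc))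
    (hη₁ : AnalyticInside (fun z => (η₁ z : ℂ))) (hη₂ : AnalyticInside (fun z => (η₂ z : ℂ)))
    (hell : ¬ IsElliptic η₁) :
    Nonempty (semicrossedProduct η₁ ≃ₐ[ℂ] semicrossedProduct η₂) ↔
      ∃ γ : Disc ≃ₜ Disc, AnalyticInside (fun z => (γ z : ℂ)) ∧ ⇑γ ∘ ⇑η₁ = ⇑η₂ ∘ ⇑γ :=
  mainTheorem7_general η₁ η₂ hη₁ hη₂ fun h => hell h.1
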